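/- **Setting.** Quantum circuits are lists of gates from the universal set $\{H, T, T^\dagger, \mathrm{CNOT}\}$; the size of a circuit is its number of gates. Polynomial time is measured on multi-stack machines over bits (equivalently, up to polynomial overhead, multitape Turing machines), circuits being encoded as bit strings with numbers in unary. For circuits $U, V$ on $n$ qubits, regarded as $2^n\times 2^n$ unitary matrices, put $$C_{\mathrm{HST}}(U,V) \;=\; 1-\frac{1}{2^{2n}}\,\bigl|\mathrm{Tr}(V^\dagger U)\bigr|^2 .$$ $\mathsf{DQC1}$ is the class of promise problems $(L_{\rm yes},L_{\rm no})$ on bit strings for which there are a polynomial $q>0$ and a polynomial-time computable map taking each input $x$ to a circuit $Q_x$ on $n_x+1$ qubits such that the one-clean-qubit acceptance probability $$p_{\rm acc}(Q_x)=\mathrm{Tr}\bigl[(|0\rangle\langle 0|\otimes \mathbb 1)\,Q_x\,\bigl(|0\rangle\langle 0|\otimes(\mathbb 1/2)^{\otimes n_x}\bigr)\,Q_x^\dagger\bigr]$$ satisfies $p_{\rm acc}(Q_x)\ge \tfrac12+1/q(|x|)$ for $x\in L_{\rm yes}$ and $p_{\rm acc}(Q_x)\le \tfrac12-1/q(|x|)$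 for $x\in L_{\rm no}$. **Theorem.** There is a polynomial $s$ such that for every $\epsilon:\mathbb N\to\mathbb R_{>0}$ with $\epsilon(n)=O(1/n^k)$ for some integer $k\ge 1$, the following problem is $\mathsf{DQC1}$-hard: given circuits $U,V$ on the same $n$ qubits, each of size at most $s(n)$, output a number $a$ with $|a-C_{\mathrm{HST}}(U,V)|\le\epsilon(n)$. Here $\mathsf{DQC1}$-hard means that every $(L_{\rm yes},L_{\rm no})\in\mathsf{DQC1}$ reduces to the problem by a polynomial-time single-query reduction: there are a polynomial-time computable map $x\mapsto(U_x,V_x)$, whose values are circuits on a common number $n'_x$ of qubits of size at most $s(n'_x)$, and a rational number $\theta$, such that for every $x$ and every real $a$ with $|a-C_{\mathrm{HST}}(U_x,V_x)|\le\epsilon(n'_x)$: if $x\in L_{\rm yes}$ then $a<\theta$, and if $x\in L_{\rm no}$ then $a>\theta$. -/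

import Mathlib

open Filter Asymptotics

noncomputable section

/-! ### Polynomial-time computation -/

/-- Programs of a multi-stack machine: finitely many stacks of bits (numbered by `ℕ`; a program
mentions only finitely many of them), with unit-cost pushes, pops and tests of the top bit. Such
machines and multitape Turing machines simulate each other with polynomial overhead. -/
inductive StackProg : Type
  | skip : StackProg
  | push (r : ℕ) (b : Bool) : StackProg
  | pop (r : ℕ) : StackProg
  | seq (p q : StackProg) : StackProg
  /-- Run `p`, `q` or `e` according to whether stack `r` has top `true`, has top `false`, or is
  empty. -/
  | branch (r : ℕ) (p q e : StackProg) : StackProg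
  /-- While stack `r` is nonempty, run `p`. -/
  | loop (r : ℕ) (p : StackProg) : StackProg

/-- `Exec p σ t τ`: started with stack contents `σ` (top of the stack = head of the list), the
program `p` halts after exactly `t` steps with stack contents `τ`. -/
inductive Exec : StackProg → (ℕ → List Bool) → ℕ → (ℕ → List Bool) → Prop
  | skip (σ : ℕ → List Bool) : Exec .skip σ 1 σ
  | push (r : ℕ) (b : Bool) (σ : ℕ → List Bool) :
      Exec (.push r b) σ 1 (Function.update σ r (b :: σ r))
  | pop (r : ℕ) (σ : ℕ → List Bool) :
      Exec (.pop r) σ 1 (Function.update σ r (σ r).tail)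
  | seq {p q : StackProg} {σ τ υ : ℕ → List Bool} {s t : ℕ} :
      Exec p σ s τ → Exec q τ t υ → Exec (.seq p q) σ (s + t) υ
  | branch_true {r : ℕ} {p q e : StackProg} {σ τ : ℕ → List Bool} {t : ℕ} :
      (σ r).head? = some true → Exec p σ t τ → Exec (.branch r p q e) σ (t + 1) τ
  | branch_false {r : ℕ} {p q e : StackProg} {σ τ : ℕ → List Bool} {t : ℕ} :
      (σ r).head? = some false → Exec q σ t τ → Exec (.branch r p q e) σ (t + 1) τ
  | branch_empty {r : ℕ} {p q e : StackProg} {σ τ : ℕ → List Bool} {t : ℕ} :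
      (σ r).head? = none → Exec e σ t τ → Exec (.branch r p q e) σ (t + 1) τ
  | loop_done {r : ℕ} {p : StackProg} {σ : ℕ → List Bool} :
      σ r = [] → Exec (.loop r p) σ 1 σ
  | loop_step {r : ℕ} {p : StackProg} {σ τ υ : ℕ → List Bool} {s t : ℕ} :
      σ r ≠ [] → Exec p σ s τ → Exec (.loop r p) τ t υ → Exec (.loop r p) σ (s + t + 1) υ

/-- `f` is computable in polynomial time, its values being written as bit strings by `enc`:
started with the input `x` on stack `0` and all other stacks empty, some program halts within
polynomially many steps in the length of `x`, leaving `enc (f x)` on stack `0`. -/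
def PolyTimeComputable {β : Type} (enc : β → List Bool) (f : List Bool → β) : Prop :=
  ∃ (prog : StackProg) (p : Polynomial ℕ), ∀ x : List Bool, ∃ (t : ℕ) (τ : ℕ → List Bool),
    Exec prog (Function.update (fun _ => []) 0 x) t τ ∧ t ≤ p.eval x.length ∧ τ 0 = enc (f x)

/-! ### Quantum circuits -/

/-- Operators on `n` qubits, as matrices indexed by the `2 ^ n` computational basis states
(`false` is `0`, `true` is `1`). -/
abbrev QubitMatrix (n : ℕ) : Type := Matrix (Fin n → Bool) (Fin n → Bool) ℂ

/-- The elementary gates on `n` qubits: the universal set Hadamard, `T`, `T†`, CNOT. -/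
inductive Gate (n : ℕ) : Type
  | H (i : Fin n) : Gate n
  | T (i : Fin n) : Gate n
  | Tdg (i : Fin n) : Gate n
  | CNOT (control target : Fin n) (h : control ≠ target) : Gate n

/-- A circuit on `n` qubits is a list of gates, the head being applied first; its size is the
length of the list. -/
abbrev Circuit (n : ℕ) : Type := List (Gate n)

/-- The Hadamard matrix. -/
def hadamardMatrix : Matrix Bool Bool ℂ :=
  Matrix.of fun a b => (if a && b then -1 else 1) / (Real.sqrt 2 : ℂ)

/-- The matrix `diag(1, e^{iθ})`. -/
def phaseMatrix (θ : ℝ) : Matrix Bool Bool ℂ :=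
  Matrix.diagonal fun a => if a then Complex.exp (θ * Complex.I) else 1

/-- The one-qubit operator `A` acting on qubit `i` of `n`, tensored with the identity elsewhere. -/
def onQubit {n : ℕ} (i : Fin n) (A : Matrix Bool Bool ℂ) : QubitMatrix n :=
  Matrix.of fun x y => if ∀ j, j ≠ i → x j = y j then A (x i) (y i) else 0

/-- The unitary matrix of a gate. -/
def Gate.toMatrix {n : ℕ} : Gate n → QubitMatrix n
  | .H i => onQubit i hadamardMatrix
  | .T i => onQubit i (phaseMatrix (Real.pi / 4))
  | .Tdg i => onQubit i (phaseMatrix (-(Real.pi / 4)))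
  | .CNOT c t _ =>
      Matrix.of fun x y => if x = Function.update y t (xor (y t) (y c)) then 1 else 0

/-- The unitary matrix of a circuit. -/
def circuitMatrix {n : ℕ} : Circuit n → QubitMatrix n
  | [] => 1
  | g :: gs => circuitMatrix gs * g.toMatrix

/-- Unary code of a natural number. -/
def encodeUnary (k : ℕ) : List Bool := List.replicate k true ++ [false]

/-- Code of a gate: two bits for its kind, then its qubits. -/
def encodeGate {n : ℕ} : Gate n → List Bool
  | .H i => [false, false] ++ encodeUnary i
  | .T i => [false, true] ++ encodeUnary i
  | .Tdg i => [true, false] ++ encodeUnary i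
  | .CNOT c t _ => [true, true] ++ encodeUnary c ++ encodeUnary t

/-- Code of the gate list of a circuit: each gate is announced by `true`, the end by `false`. -/
def encodeGates {n : ℕ} : Circuit n → List Bool
  | [] => [false]
  | g :: gs => true :: (encodeGate g ++ encodeGates gs)

/-! ### The Hilbert-Schmidt test cost -/

/-- `C_HST(U, V) = 1 - |Tr(V† U)|² / d²` with `d = 2 ^ n`. -/
def costHST {n : ℕ} (U V : QubitMatrix n) : ℝ :=
  1 - 1 / ((2 : ℝ) ^ n) ^ 2 * ‖Matrix.trace (V.conjTranspose * U)‖ ^ 2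

/-! ### The one-clean-qubit model -/

/-- A one-clean-qubit computation: a number `n` of maximally mixed qubits and a circuit on
`n + 1` qubits, of which qubit `0` is the clean one. -/
structure OneCleanQubitCircuit : Type where
  n : ℕ
  circuit : Circuit (n + 1)

/-- Code of a one-clean-qubit computation. -/
def OneCleanQubitCircuit.encode (Q : OneCleanQubitCircuit) : List Bool :=
  encodeUnary Q.n ++ encodeGates Q.circuit

/-- The projector `|0⟩⟨0| ⊗ 1` onto the outcome `0` of the clean qubit. -/
def cleanProjector (n : ℕ) : QubitMatrix (n + 1) :=
  Matrix.diagonal fun x => if x 0 = false then 1 else 0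

/-- The input state `ρ = |0⟩⟨0| ⊗ (1/2)^{⊗ n}`. -/
def cleanInput (n : ℕ) : QubitMatrix (n + 1) :=
  Matrix.diagonal fun x => if x 0 = false then (1 / 2 : ℂ) ^ n else 0

/-- The probability `Tr[(|0⟩⟨0| ⊗ 1) Q ρ Q†]` of the outcome `0` on the clean qubit (this trace
is a real number). -/
def OneCleanQubitCircuit.acceptProb (Q : OneCleanQubitCircuit) : ℝ :=
  (Matrix.trace (cleanProjector Q.n * circuitMatrix Q.circuit * cleanInput Q.n *
    (circuitMatrix Q.circuit).conjTranspose)).re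

/-- A promise problem on bit strings. -/
structure PromiseProblem : Type where
  yes : Set (List Bool)
  no : Set (List Bool)

/-- The class DQC1: one-clean-qubit computations, prepared in polynomial time from the input, whose
acceptance probability is bounded away from `1/2` by an inverse polynomial, above it on
yes-instances and below it on no-instances. Constant gaps such as `2/3` against `1/3` are a special
case; a polynomial number of repetitions turns the inverse-polynomial gap into bounded error. -/
def DQC1 : Set PromiseProblem :=
  {L | ∃ Q : List Bool → OneCleanQubitCircuit,
    PolyTimeComputable OneCleanQubitCircuit.encode Q ∧
    ∃ q : Polynomial ℕ, (∀ m, 0 < q.eval m) ∧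
      (∀ x ∈ L.yes, 1 / 2 + 1 / ((q.eval x.length : ℕ) : ℝ) ≤ (Q x).acceptProb) ∧
      (∀ x ∈ L.no, (Q x).acceptProb ≤ 1 / 2 - 1 / ((q.eval x.length : ℕ) : ℝ))}

/-! ### Approximation problems and hardness -/

/-- The problem of approximating a real quantity: given (the code of) an admissible instance `i`,
output some number `a` with `|a - value i| ≤ precision i`. -/
structure ApproxProblem : Type 1 where
  Inst : Type
  encode : Inst → List Bool
  admissible : Set Inst
  value : Inst → ℝ
  precision : Inst → ℝ

/-- `a` is a correct output for the instance `i`. -/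
def ApproxProblem.IsSolution (P : ApproxProblem) (i : P.Inst) (a : ℝ) : Prop :=
  |a - P.value i| ≤ P.precision i

/-- `L` reduces to `P` in polynomial time, with a single query: an admissible instance `f x` of `P`
is computed from `x` in polynomial time, and every correct output for `f x` decides `x` by
comparison with a fixed rational threshold. -/
def ReducesTo (L : PromiseProblem) (P : ApproxProblem) : Prop :=
  ∃ f : List Bool → P.Inst, PolyTimeComputable P.encode f ∧ (∀ x, f x ∈ P.admissible) ∧
    ∃ θ : ℚ, ∀ (x : List Bool) (a : ℝ), P.IsSolution (f x) a →
      (x ∈ L.yes → a < θ) ∧ (x ∈ L.no → (θ : ℝ) < a)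

/-- Every problem in DQC1 reduces to `P` in polynomial time. -/
def DQC1Hard (P : ApproxProblem) : Prop := ∀ L ∈ DQC1, ReducesTo L P

/-- A pair of circuits `U`, `V` on the same `n` qubits. -/
structure CircuitPair : Type where
  n : ℕ
  U : Circuit n
  V : Circuit n

/-- Code of a pair of circuits. -/
def CircuitPair.encode (i : CircuitPair) : List Bool :=
  encodeUnary i.n ++ encodeGates i.U ++ encodeGates i.V

/-- Approximating `C_HST(U, V)` up to precision `ε n`, for circuits `U`, `V` on `n` qubits with at
most `s n` gates each. -/
def approxCostHST (s : Polynomial ℕ) (ε : ℕ → ℝ) : ApproxProblem where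
  Inst := CircuitPair
  encode := CircuitPair.encode
  admissible := {i | i.U.length ≤ s.eval i.n ∧ i.V.length ≤ s.eval i.n}
  value i := costHST (circuitMatrix i.U) (circuitMatrix i.V)
  precision i := ε i.n

end

/-!
Let `C` be a one-clean-qubit circuit on `n + 1` qubits and `Z` the Pauli operator on the clean one.
Since `|0⟩⟨0| ⊗ 1 = (1 + Z) / 2` and `Z` is traceless, the acceptance probability is
`p = (1 + Tr(C† Z C Z) / 2 ^ (n + 1)) / 2`, an affine function of the trace of a unitary. The same
affine function arises from a further qubit that controls the two `Z`s: with the control at `0` the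
product `C† Z C Z` becomes `C† C = 1`, and with the control at `1` it stays as it is, so that the
normalized trace of `C† CZ C CZ` is the average of `1` and `Tr(C† Z C Z) / 2 ^ (n + 1)`, that is, `p`
itself (`trace_overlap`, `trace_accept`). Hence the circuits `CZ C CZ` and `C` have Hilbert-Schmidt
cost `1 - p ^ 2` (`costHST_controlledZ_conj`). As `p ≥ 0`, an inverse-polynomial gap of `p` around
`1 / 2` is one of the cost around `3 / 4`. The controlled `Z` is the conjugate of a CNOT by Hadamards
and costs three gates.

Idle qubits change neither normalized traces nor the codes of gates. Padding the register to
`(|x| + c) ^ d + 1` qubits therefore makes the allowed error, which is `O(1 / n)`, smaller than the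
gap, and makes the size of the circuits at most linear in the number of qubits.

That the reduction runs in polynomial time is shown by an explicit stack program: it computes
`(|x| + c) ^ d` in unary by repeated multiplication on stacks that the program for `C` does not
mention, runs that program, which leaves those stacks alone (`Exec.frame`), and assembles the code
of the pair of circuits (`polyTimeComputable_pair`). The control is the last qubit, whose unary
code is the computed number.
-/

noncomputable section

/-! ### One-qubit operators and unitarity of circuits -/

theorem onQubit_eq_submatrix {n : ℕ} (i : Fin n) (A : Matrix Bool Bool ℂ) :
    onQubit i A = (Matrix.blockDiagonal fun _ : {j // j ≠ i} → Bool => A).submatrix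
      (Equiv.funSplitAt i Bool) (Equiv.funSplitAt i Bool) := by
  ext x y
  simp only [onQubit, Matrix.of_apply, Matrix.submatrix_apply, Matrix.blockDiagonal_apply,
    Equiv.funSplitAt_apply, funext_iff, Subtype.forall]

theorem onQubit_mul {n : ℕ} (i : Fin n) (A B : Matrix Bool Bool ℂ) :
    onQubit i A * onQubit i B = onQubit i (A * B) := by
  simp only [onQubit_eq_submatrix, Matrix.submatrix_mul_equiv, ← Matrix.blockDiagonal_mul]

theorem onQubit_one {n : ℕ} (i : Fin n) : onQubit i 1 = 1 := by
  rw [onQubit_eq_submatrix]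
  have := Matrix.blockDiagonal_one (m := Bool) (o := {j // j ≠ i} → Bool) (α := ℂ)
  rw [Pi.one_def] at this
  rw [this, Matrix.submatrix_one_equiv]

theorem conjTranspose_onQubit {n : ℕ} (i : Fin n) (A : Matrix Bool Bool ℂ) :
    (onQubit i A).conjTranspose = onQubit i A.conjTranspose := by
  simp only [onQubit_eq_submatrix, Matrix.conjTranspose_submatrix,
    Matrix.blockDiagonal_conjTranspose]

theorem hadamardMatrix_conjTranspose : hadamardMatrix.conjTranspose = hadamardMatrix := by
  ext a b
  cases a <;> cases b <;> simp [hadamardMatrix]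

/-- The Pauli operator `Z`. -/
def pauliZ : Matrix Bool Bool ℂ := Matrix.diagonal fun a => if a then -1 else 1

/-- The Pauli operator `X`. -/
def pauliX : Matrix Bool Bool ℂ := Matrix.of fun a b => if a = !b then 1 else 0

theorem sqrt_two_mul_self : (Real.sqrt 2 : ℂ) * (Real.sqrt 2 : ℂ) = 2 := by
  rw [← Complex.ofReal_mul, Real.mul_self_sqrt (by norm_num)]; norm_num

theorem hadamardMatrix_eq : hadamardMatrix =
    (Real.sqrt 2 : ℂ)⁻¹ • Matrix.of fun a b => if a && b then -1 else 1 := by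
  ext a b
  simp [hadamardMatrix, div_eq_inv_mul]

theorem inv_sqrt_two_mul_self : (Real.sqrt 2 : ℂ)⁻¹ * (Real.sqrt 2 : ℂ)⁻¹ = 2⁻¹ := by
  rw [← mul_inv, sqrt_two_mul_self]

theorem hadamardMatrix_mul_self : hadamardMatrix * hadamardMatrix = 1 := by
  rw [hadamardMatrix_eq, Matrix.smul_mul, Matrix.mul_smul, smul_smul, inv_sqrt_two_mul_self]
  ext a b
  cases a <;> cases b <;> simp [Matrix.mul_apply]; norm_num

theorem hadamardMatrix_mul_pauliX_mul_hadamardMatrix :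
    hadamardMatrix * pauliX * hadamardMatrix = pauliZ := by
  rw [hadamardMatrix_eq, Matrix.mul_smul, Matrix.smul_mul, Matrix.smul_mul, smul_smul,
    inv_sqrt_two_mul_self]
  ext a b
  cases a <;> cases b <;> simp [Matrix.mul_apply, pauliX, pauliZ]; norm_num

theorem phaseMatrix_conjTranspose_mul_self (θ : ℝ) :
    (phaseMatrix θ).conjTranspose * phaseMatrix θ = 1 := by
  rw [phaseMatrix, Matrix.diagonal_conjTranspose, Matrix.diagonal_mul_diagonal,
    ← Matrix.diagonal_one]
  congr 1
  ext a
  cases a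
  · simp
  · simp [← Complex.exp_conj, ← Complex.exp_add]

theorem onQubit_unitary {n : ℕ} (i : Fin n) {A : Matrix Bool Bool ℂ}
    (hA : A.conjTranspose * A = 1) : (onQubit i A).conjTranspose * onQubit i A = 1 := by
  rw [conjTranspose_onQubit, onQubit_mul, hA, onQubit_one]

theorem Gate.conjTranspose_toMatrix_mul_self {n : ℕ} (g : Gate n) :
    g.toMatrix.conjTranspose * g.toMatrix = 1 := by
  cases g with
  | H i => exact onQubit_unitary i (by rw [hadamardMatrix_conjTranspose, hadamardMatrix_mul_self])
  | T i => exact onQubit_unitary i (phaseMatrix_conjTranspose_mul_self _)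
  | Tdg i => exact onQubit_unitary i (phaseMatrix_conjTranspose_mul_self _)
  | CNOT c t h =>
    have inj : Function.Injective
        fun y : Fin n → Bool => Function.update y t (xor (y t) (y c)) := by
      intro y z hyz
      have hc : y c = z c := by simpa [h] using congrFun hyz c
      funext j
      have hj := congrFun hyz j
      by_cases hjt : j = t
      · subst hjt
        simpa [hc] using hj
      · simpa [hjt] using hj
    ext x y
    simp [Gate.toMatrix, Matrix.mul_apply, Matrix.one_apply, apply_ite, inj.eq_iff, eq_comm]

theorem circuitMatrix_append {n : ℕ} (C D : Circuit n) :
    circuitMatrix (C ++ D) = circuitMatrix D * circuitMatrix C := by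
  induction C with
  | nil => simp [circuitMatrix]
  | cons g C ih => simp [circuitMatrix, ih, Matrix.mul_assoc]

theorem conjTranspose_circuitMatrix_mul_self {n : ℕ} (C : Circuit n) :
    (circuitMatrix C).conjTranspose * circuitMatrix C = 1 := by
  induction C with
  | nil => simp [circuitMatrix]
  | cons g C ih =>
    rw [circuitMatrix, Matrix.conjTranspose_mul, Matrix.mul_assoc,
      ← Matrix.mul_assoc _ (circuitMatrix C), ih, Matrix.one_mul,
      g.conjTranspose_toMatrix_mul_self]

/-! ### Operators controlled by additional qubits -/

/-- Operators on the first `m` of `m + e` qubits, controlled by the basis state of the last `e`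
qubits: if these are in state `z`, then `M z` acts on the first `m`. -/
def controlledBy {m e : ℕ} (M : (Fin e → Bool) → QubitMatrix m) : QubitMatrix (m + e) :=
  (Matrix.blockDiagonal M).submatrix (Fin.appendEquiv m e).symm (Fin.appendEquiv m e).symm

theorem controlledBy_append {m e : ℕ} (M : (Fin e → Bool) → QubitMatrix m)
    (x y : Fin m → Bool) (z w : Fin e → Bool) :
    controlledBy M (Fin.append x z) (Fin.append y w) = if z = w then M z x y else 0 := by
  simp only [controlledBy, Matrix.submatrix_apply]
  rw [show Fin.append x z = Fin.appendEquiv m e (x, z) from rfl,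
    show Fin.append y w = Fin.appendEquiv m e (y, w) from rfl]
  simp [Matrix.blockDiagonal_apply]

theorem eq_controlledBy {m e : ℕ} {A : QubitMatrix (m + e)} {M : (Fin e → Bool) → QubitMatrix m}
    (h : ∀ x y z w, A (Fin.append x z) (Fin.append y w) = if z = w then M z x y else 0) :
    A = controlledBy M := by
  ext x y
  rw [← Fin.append_castAdd_natAdd (f := x), ← Fin.append_castAdd_natAdd (f := y), h,
    controlledBy_append]

theorem controlledBy_mul {m e : ℕ} (M N : (Fin e → Bool) → QubitMatrix m) :
    controlledBy M * controlledBy N = controlledBy fun z => M z * N z := by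
  simp only [controlledBy, Matrix.submatrix_mul_equiv, ← Matrix.blockDiagonal_mul]

theorem conjTranspose_controlledBy {m e : ℕ} (M : (Fin e → Bool) → QubitMatrix m) :
    (controlledBy M).conjTranspose = controlledBy fun z => (M z).conjTranspose := by
  simp only [controlledBy, Matrix.conjTranspose_submatrix, Matrix.blockDiagonal_conjTranspose]

theorem controlledBy_one {m e : ℕ} :
    controlledBy (fun _ : Fin e → Bool => (1 : QubitMatrix m)) = 1 := by
  have := Matrix.blockDiagonal_one (m := Fin m → Bool) (o := Fin e → Bool) (α := ℂ)
  rw [Pi.one_def] at this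
  rw [controlledBy, this, Matrix.submatrix_one_equiv]

theorem trace_controlledBy {m e : ℕ} (M : (Fin e → Bool) → QubitMatrix m) :
    (controlledBy M).trace = ∑ z, (M z).trace := by
  rw [← Matrix.trace_blockDiagonal]
  simp only [controlledBy, Matrix.trace, Matrix.diag_apply, Matrix.submatrix_apply]
  exact Equiv.sum_comp (Fin.appendEquiv m e).symm fun p => Matrix.blockDiagonal M p p

/-- A gate, regarded as a gate on a register extended by `e` further qubits. -/
def Gate.extend {m : ℕ} (e : ℕ) : Gate m → Gate (m + e)
  | .H i => .H (i.castAdd e)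
  | .T i => .T (i.castAdd e)
  | .Tdg i => .Tdg (i.castAdd e)
  | .CNOT c t h => .CNOT (c.castAdd e) (t.castAdd e)
      fun h' => h (Fin.castAdd_injective m e h')

theorem onQubit_castAdd {m : ℕ} (e : ℕ) (i : Fin m) (A : Matrix Bool Bool ℂ) :
    onQubit (i.castAdd e) A = controlledBy fun _ => onQubit i A := by
  refine eq_controlledBy fun x y z w => ?_
  have : (∀ j, j ≠ i.castAdd e → Fin.append x z j = Fin.append y w j) ↔
      z = w ∧ ∀ j, j ≠ i → x j = y j := by
    rw [Fin.forall_fin_add]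
    simp only [ne_eq, Fin.append_left, Fin.append_right, (Fin.castAdd_injective m e).eq_iff,
      funext_iff]
    constructor
    · rintro ⟨h1, h2⟩
      exact ⟨fun j => h2 j (by simp [Fin.ext_iff]; omega), h1⟩
    · rintro ⟨h1, h2⟩
      exact ⟨h2, fun j _ => h1 j⟩
  simp only [onQubit, Matrix.of_apply, this, Fin.append_left]
  split_ifs <;> simp_all

theorem Fin.update_append_left {m e : ℕ} {α : Type*} (x : Fin m → α) (z : Fin e → α) (i : Fin m)
    (a : α) : Function.update (Fin.append x z) (i.castAdd e) a =
      Fin.append (Function.update x i a) z := by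
  rw [funext_iff, Fin.forall_fin_add]
  constructor
  · intro j
    simp [Function.update_apply, (Fin.castAdd_injective m e).eq_iff]
  · intro j
    have : Fin.natAdd m j ≠ i.castAdd e := by simp [Fin.ext_iff]; omega
    simp [this]

theorem Fin.append_eq_append_iff {m e : ℕ} {α : Type*} {x y : Fin m → α} {z w : Fin e → α} :
    Fin.append x z = Fin.append y w ↔ x = y ∧ z = w := by
  rw [← Prod.mk_inj]
  exact (Fin.appendEquiv m e).injective.eq_iff (a := (x, z)) (b := (y, w))

theorem Gate.toMatrix_extend {m : ℕ} (e : ℕ) (g : Gate m) :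
    (g.extend e).toMatrix = controlledBy fun _ => g.toMatrix := by
  cases g with
  | H i => exact onQubit_castAdd e i _
  | T i => exact onQubit_castAdd e i _
  | Tdg i => exact onQubit_castAdd e i _
  | CNOT c t h =>
    refine eq_controlledBy fun x y z w => ?_
    simp only [Gate.extend, Gate.toMatrix, Matrix.of_apply, Fin.append_left,
      Fin.update_append_left, Fin.append_eq_append_iff]
    split_ifs <;> simp_all

theorem circuitMatrix_map_extend {m : ℕ} (e : ℕ) (C : Circuit m) :
    circuitMatrix (C.map (Gate.extend e)) = controlledBy fun _ => circuitMatrix C := by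
  induction C with
  | nil => simp [circuitMatrix, controlledBy_one]
  | cons g C ih => simp only [List.map_cons, circuitMatrix, ih, g.toMatrix_extend, controlledBy_mul]

/-- The controlled `Z` of qubit `0` with the last of `e + 1` additional qubits, as a Hadamard
conjugate of a CNOT. -/
def controlledZ (n e : ℕ) : Circuit (n + 1 + (e + 1)) :=
  [.H (Fin.castAdd (e + 1) 0),
    .CNOT (Fin.natAdd (n + 1) (Fin.last e)) (Fin.castAdd (e + 1) 0)
      (by simp [Fin.ext_iff]),
    .H (Fin.castAdd (e + 1) 0)]

theorem toMatrix_CNOT_natAdd {m e : ℕ} (c : Fin e) (t : Fin m)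
    (h : Fin.natAdd m c ≠ Fin.castAdd e t) :
    (Gate.CNOT (Fin.natAdd m c) (Fin.castAdd e t) h).toMatrix =
      controlledBy fun z => if z c then onQubit t pauliX else 1 := by
  refine eq_controlledBy fun x y z w => ?_
  simp only [Gate.toMatrix, Matrix.of_apply, Fin.append_left, Fin.append_right,
      Fin.update_append_left, Fin.append_eq_append_iff]
  by_cases hz : z = w
  · subst hz
    cases hc : z c
    · simp [Matrix.one_apply]
    · have : x = Function.update y t (!y t) ↔ (∀ j, j ≠ t → x j = y j) ∧ x t = !y t := by
        constructor
        · rintro rfl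
          simp +contextual
        · rintro ⟨h1, h2⟩
          funext j
          by_cases hj : j = t
          · subst hj; simp [h2]
          · simp [hj, h1]
      simp only [Bool.xor_true, this, and_true, onQubit, pauliX, Matrix.of_apply, if_true, ite_and]
  · simp [hz]

theorem circuitMatrix_controlledZ (n e : ℕ) : circuitMatrix (controlledZ n e) =
    controlledBy fun z => if z (Fin.last e) then onQubit 0 pauliZ else 1 := by
  simp only [controlledZ, circuitMatrix, toMatrix_CNOT_natAdd]
  simp only [Gate.toMatrix, onQubit_castAdd, controlledBy_mul, Matrix.one_mul]
  congr 1
  funext z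
  split_ifs
  · rw [onQubit_mul, onQubit_mul, hadamardMatrix_mul_pauliX_mul_hadamardMatrix]
  · rw [Matrix.mul_one, onQubit_mul, hadamardMatrix_mul_self, onQubit_one]

/-! ### The acceptance probability as a Hilbert-Schmidt overlap -/

theorem card_filter_last (e : ℕ) (b : Bool) :
    (Finset.univ.filter fun z : Fin (e + 1) → Bool => z (Fin.last e) = b).card = 2 ^ e := by
  rw [← Fintype.card_subtype]
  have : {z : Fin (e + 1) → Bool // z (Fin.last e) = b} ≃ (Fin e → Bool) :=
    { toFun := fun z => Fin.init z.1
      invFun := fun z => ⟨Fin.snoc z b, by simp⟩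
      left_inv := fun ⟨z, hz⟩ => by subst hz; simp
      right_inv := fun z => by simp }
  rw [Fintype.card_congr this]
  simp

/-- On the half of the basis states `z` of the additional qubits that leave the control at `0`, the
two circuits agree and contribute `Tr 1`; on the other half `Z` acts before and after `C`. -/
theorem trace_overlap {n e : ℕ} (C : Circuit (n + 1)) :
    Matrix.trace ((circuitMatrix (C.map (Gate.extend (e + 1)))).conjTranspose *
      circuitMatrix (controlledZ n e ++ C.map (Gate.extend (e + 1)) ++ controlledZ n e)) =
    2 ^ e * (2 ^ (n + 1) + Matrix.trace ((circuitMatrix C).conjTranspose *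
      (onQubit 0 pauliZ * (circuitMatrix C * onQubit 0 pauliZ)))) := by
  simp only [circuitMatrix_append, circuitMatrix_map_extend, circuitMatrix_controlledZ,
    controlledBy_mul, conjTranspose_controlledBy, trace_controlledBy]
  have key (z : Fin (e + 1) → Bool) : Matrix.trace ((circuitMatrix C).conjTranspose *
      ((if z (Fin.last e) then onQubit 0 pauliZ else 1) *
        (circuitMatrix C * if z (Fin.last e) then onQubit 0 pauliZ else 1))) =
      if z (Fin.last e) = true then Matrix.trace ((circuitMatrix C).conjTranspose *
        (onQubit 0 pauliZ * (circuitMatrix C * onQubit 0 pauliZ))) else 2 ^ (n + 1) := by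
    split_ifs
    · rfl
    · simp [conjTranspose_circuitMatrix_mul_self, Matrix.trace_one]
  simp only [key, Finset.sum_ite, Finset.sum_const, Bool.not_eq_true, card_filter_last,
    nsmul_eq_mul]
  push_cast
  ring

theorem onQubit_zero_pauliZ (n : ℕ) : onQubit (0 : Fin (n + 1)) pauliZ =
    Matrix.diagonal fun x => if x 0 then -1 else 1 := by
  ext x y
  simp only [onQubit, pauliZ, Matrix.of_apply, Matrix.diagonal_apply]
  by_cases h : x = y
  · simp [h]
  · rw [if_neg h]
    split_ifs with h1 h2 <;> try rfl
    all_goals exact absurd (funext fun j => by by_cases hj : j = 0 <;> simp_all) h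

theorem trace_onQubit_zero_pauliZ (n : ℕ) :
    Matrix.trace (onQubit (0 : Fin (n + 1)) pauliZ) = 0 := by
  rw [onQubit_zero_pauliZ, Matrix.trace_diagonal,
    ← Equiv.sum_comp (Fin.consEquiv fun _ : Fin (n + 1) => Bool), Fintype.sum_prod_type]
  simp [Fin.consEquiv]

theorem cleanProjector_eq (n : ℕ) :
    cleanProjector n = (1 / 2 : ℂ) • (1 + onQubit 0 pauliZ) := by
  rw [onQubit_zero_pauliZ, ← Matrix.diagonal_one, Matrix.diagonal_add, ← Matrix.diagonal_smul,
    cleanProjector]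
  congr 1
  funext x
  cases h : x 0 <;> simp [h]
  norm_num

theorem cleanInput_eq (n : ℕ) :
    cleanInput n = ((1 / 2 : ℂ) ^ n * (1 / 2)) • (1 + onQubit 0 pauliZ) := by
  rw [mul_smul, ← cleanProjector_eq, cleanInput, cleanProjector, ← Matrix.diagonal_smul]
  congr 1
  funext x
  simp

/-- The trace that defines the acceptance probability, expanded with `|0⟩⟨0| ⊗ 1 = (1 + Z) / 2`.
The terms linear in `Z` vanish because `Z` is traceless. -/
theorem trace_accept (Q : OneCleanQubitCircuit) :
    Matrix.trace (cleanProjector Q.n * circuitMatrix Q.circuit * cleanInput Q.n *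
      (circuitMatrix Q.circuit).conjTranspose) * 2 ^ (Q.n + 2) =
    2 ^ (Q.n + 1) + Matrix.trace ((circuitMatrix Q.circuit).conjTranspose *
      (onQubit 0 pauliZ * (circuitMatrix Q.circuit * onQubit 0 pauliZ))) := by
  have hu := conjTranspose_circuitMatrix_mul_self Q.circuit
  have hu' := mul_eq_one_comm.mp hu
  set A := circuitMatrix Q.circuit
  set Z : QubitMatrix (Q.n + 1) := onQubit 0 pauliZ with hZ
  have htr : Z.trace = 0 := trace_onQubit_zero_pauliZ _
  have h1 : ((1 + Z) * A * (1 + Z) * A.conjTranspose).trace =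
      2 ^ (Q.n + 1) + (A.conjTranspose * (Z * (A * Z))).trace := by
    have e1 : (1 + Z) * A * (1 + Z) * A.conjTranspose =
        A * A.conjTranspose + A * (Z * A.conjTranspose) + Z * (A * A.conjTranspose) +
          Z * (A * Z) * A.conjTranspose := by noncomm_ring
    rw [e1, hu', Matrix.trace_add, Matrix.trace_add, Matrix.trace_add,
      Matrix.trace_mul_comm A, Matrix.mul_assoc Z, hu, Matrix.mul_one, htr,
      Matrix.trace_mul_comm _ A.conjTranspose, Matrix.trace_one]
    simp
  rw [cleanProjector_eq, cleanInput_eq, ← h1]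
  simp only [Matrix.smul_mul, Matrix.mul_smul, Matrix.trace_smul, smul_eq_mul, ← hZ]
  rw [pow_add, one_div, inv_pow]
  field_simp

/-- The trace is `∑ x y, d x * d' y * ‖C x y‖ ^ 2` with nonnegative diagonals `d`, `d'`. -/
theorem trace_accept_nonneg (Q : OneCleanQubitCircuit) :
    ∃ p : ℝ, 0 ≤ p ∧ Matrix.trace (cleanProjector Q.n * circuitMatrix Q.circuit * cleanInput Q.n *
      (circuitMatrix Q.circuit).conjTranspose) = p := by
  refine ⟨∑ x, ∑ y, (if x 0 = false then 1 else 0) *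
    (if y 0 = false then (1 / 2) ^ Q.n else 0) * ‖circuitMatrix Q.circuit x y‖ ^ 2, ?_, ?_⟩
  · refine Finset.sum_nonneg fun x _ => Finset.sum_nonneg fun y _ => ?_
    split_ifs <;> positivity
  · simp only [Matrix.trace, Matrix.diag_apply]
    push_cast
    refine Finset.sum_congr rfl fun x _ => ?_
    rw [Matrix.mul_apply]
    refine Finset.sum_congr rfl fun y _ => ?_
    rw [cleanInput, Matrix.mul_diagonal, cleanProjector, Matrix.diagonal_mul,
      Matrix.conjTranspose_apply, ← Complex.mul_conj']
    simp only [RCLike.star_def, apply_ite (Complex.ofReal), Complex.ofReal_one,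
      Complex.ofReal_zero, Complex.ofReal_pow, Complex.ofReal_div, Complex.ofReal_ofNat]
    ring

theorem OneCleanQubitCircuit.acceptProb_nonneg (Q : OneCleanQubitCircuit) : 0 ≤ Q.acceptProb := by
  obtain ⟨p, hp, h⟩ := trace_accept_nonneg Q
  rw [acceptProb, h]
  simpa using hp

/-- Comparing a one-clean-qubit circuit `C` with its conjugate by the controlled `Z` gives a
Hilbert-Schmidt cost that determines the acceptance probability: the normalized overlap is
`(1 + Tr(C† Z C Z) / 2 ^ (n + 1)) / 2`, which is the acceptance probability itself. -/
theorem costHST_controlledZ_conj (Q : OneCleanQubitCircuit) (e : ℕ) :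
    costHST (circuitMatrix (controlledZ Q.n e ++ Q.circuit.map (Gate.extend (e + 1)) ++
      controlledZ Q.n e)) (circuitMatrix (Q.circuit.map (Gate.extend (e + 1)))) =
    1 - Q.acceptProb ^ 2 := by
  obtain ⟨p, hp, h⟩ := trace_accept_nonneg Q
  have hacc : Q.acceptProb = p := by rw [OneCleanQubitCircuit.acceptProb, h, Complex.ofReal_re]
  rw [costHST, trace_overlap, ← trace_accept, h, hacc, norm_mul, norm_mul, norm_pow, norm_pow,
    Complex.norm_real, Complex.norm_ofNat, Real.norm_of_nonneg hp]
  have : (2 : ℝ) ^ (Q.n + 1 + (e + 1)) = 2 ^ e * 2 ^ (Q.n + 2) := by ring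
  rw [this]
  field_simp

/-! ### Locality and growth of stack programs -/

/-- An exclusive bound on the numbers of the stacks that a program mentions. -/
def StackProg.bound : StackProg → ℕ
  | .skip => 0
  | .push r _ => r + 1
  | .pop r => r + 1
  | .seq p q => max p.bound q.bound
  | .branch r p q e => max (r + 1) (max p.bound (max q.bound e.bound))
  | .loop r p => max (r + 1) p.bound

/-- A program neither reads nor changes the stacks that it does not mention. -/
theorem Exec.frame {p : StackProg} {σ τ : ℕ → List Bool} {t : ℕ} (h : Exec p σ t τ) {K : ℕ}
    (hK : p.bound ≤ K) {σ' : ℕ → List Bool} (hσ : ∀ s < K, σ' s = σ s) :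
    ∃ τ', Exec p σ' t τ' ∧ (∀ s < K, τ' s = τ s) ∧ ∀ s, K ≤ s → τ' s = σ' s := by
  induction h generalizing σ' with
  | skip σ => exact ⟨σ', .skip _, hσ, fun _ _ => rfl⟩
  | push r b σ =>
    simp only [StackProg.bound] at hK
    refine ⟨_, .push r b σ', fun s hs => ?_, fun s hs => ?_⟩
    · simp only [Function.update_apply, hσ s hs, hσ r hK]
    · rw [Function.update_of_ne (by omega)]
  | pop r σ =>
    simp only [StackProg.bound] at hK
    refine ⟨_, .pop r σ', fun s hs => ?_, fun s hs => ?_⟩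
    · simp only [Function.update_apply, hσ s hs, hσ r hK]
    · rw [Function.update_of_ne (by omega)]
  | seq _ _ ih₁ ih₂ =>
    simp only [StackProg.bound, max_le_iff] at hK
    obtain ⟨τ₁, e₁, l₁, u₁⟩ := ih₁ hK.1 hσ
    obtain ⟨τ₂, e₂, l₂, u₂⟩ := ih₂ hK.2 l₁
    exact ⟨τ₂, .seq e₁ e₂, l₂, fun s hs => (u₂ s hs).trans (u₁ s hs)⟩
  | branch_true hr _ ih =>
    simp only [StackProg.bound, max_le_iff] at hK
    obtain ⟨τ₁, e₁, l₁, u₁⟩ := ih hK.2.1 hσ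
    exact ⟨τ₁, .branch_true (by rw [hσ _ hK.1, hr]) e₁, l₁, u₁⟩
  | branch_false hr _ ih =>
    simp only [StackProg.bound, max_le_iff] at hK
    obtain ⟨τ₁, e₁, l₁, u₁⟩ := ih hK.2.2.1 hσ
    exact ⟨τ₁, .branch_false (by rw [hσ _ hK.1, hr]) e₁, l₁, u₁⟩
  | branch_empty hr _ ih =>
    simp only [StackProg.bound, max_le_iff] at hK
    obtain ⟨τ₁, e₁, l₁, u₁⟩ := ih hK.2.2.2 hσ
    exact ⟨τ₁, .branch_empty (by rw [hσ _ hK.1, hr]) e₁, l₁, u₁⟩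
  | loop_done hr =>
    simp only [StackProg.bound, max_le_iff] at hK
    exact ⟨σ', .loop_done (by rw [hσ _ hK.1, hr]), hσ, fun _ _ => rfl⟩
  | loop_step hr _ _ ih₁ ih₂ =>
    have hK' := hK
    simp only [StackProg.bound, max_le_iff] at hK
    obtain ⟨τ₁, e₁, l₁, u₁⟩ := ih₁ hK.2 hσ
    obtain ⟨τ₂, e₂, l₂, u₂⟩ := ih₂ hK' l₁
    exact ⟨τ₂, .loop_step (by rwa [hσ _ hK.1]) e₁ e₂, l₂, fun s hs => (u₂ s hs).trans (u₁ s hs)⟩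

/-- A stack grows by at most one bit in a step. -/
theorem Exec.length_le {p : StackProg} {σ τ : ℕ → List Bool} {t : ℕ} (h : Exec p σ t τ) (s : ℕ) :
    (τ s).length ≤ (σ s).length + t := by
  induction h with
  | skip σ => omega
  | push r b σ => by_cases hs : s = r <;> simp [hs]
  | pop r σ => by_cases hs : s = r <;> simp [hs]; omega
  | loop_done => omega
  | _ => omega

/-! ### Moving and multiplying stack contents -/

/-- `p` takes the stack contents `σ` to `τ` in at most `b` steps. -/
def RunsWithin (p : StackProg) (σ : ℕ → List Bool) (b : ℕ) (τ : ℕ → List Bool) : Prop :=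
  ∃ t ≤ b, Exec p σ t τ

theorem RunsWithin.seq {p q : StackProg} {σ τ υ : ℕ → List Bool} {a b : ℕ}
    (h₁ : RunsWithin p σ a τ) (h₂ : RunsWithin q τ b υ) : RunsWithin (.seq p q) σ (a + b) υ := by
  obtain ⟨s, hs, e₁⟩ := h₁
  obtain ⟨t, ht, e₂⟩ := h₂
  exact ⟨s + t, by omega, .seq e₁ e₂⟩

theorem RunsWithin.mono {p : StackProg} {σ τ : ℕ → List Bool} {a b : ℕ}
    (h : RunsWithin p σ a τ) (hab : a ≤ b) : RunsWithin p σ b τ := by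
  obtain ⟨t, ht, e⟩ := h
  exact ⟨t, ht.trans hab, e⟩

theorem runsWithin_push (r : ℕ) (b : Bool) (σ : ℕ → List Bool) :
    RunsWithin (.push r b) σ 1 (Function.update σ r (b :: σ r)) := ⟨1, le_rfl, .push r b σ⟩

theorem runsWithin_pop {r : ℕ} {σ : ℕ → List Bool} {b : Bool} {l : List Bool} (h : σ r = b :: l) :
    RunsWithin (.pop r) σ 1 (Function.update σ r l) :=
  ⟨1, le_rfl, by simpa [h] using Exec.pop r σ⟩

/-- Push the word `l` on stack `r`, so that it can be read from the top. -/
def pushList (r : ℕ) : List Bool → StackProg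
  | [] => .skip
  | b :: l => .seq (pushList r l) (.push r b)

theorem runsWithin_pushList (r : ℕ) (l : List Bool) (σ : ℕ → List Bool) :
    RunsWithin (pushList r l) σ (l.length + 1) (Function.update σ r (l ++ σ r)) := by
  induction l with
  | nil => exact ⟨1, by simp, by simpa [pushList] using Exec.skip σ⟩
  | cons b l ih =>
    have h := ih.seq (runsWithin_push r b _)
    rwa [Function.update_self, Function.update_idem] at h

/-- The stack contents `σ` with the word `l` put on top of each of the stacks in `ts`. -/
def putOn (ts : List ℕ) (l : List Bool) (σ : ℕ → List Bool) : ℕ → List Bool :=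
  fun s => if s ∈ ts then l ++ σ s else σ s

/-- Push the bit `b` on each of the stacks in `ts`. -/
def pushAll (b : Bool) : List ℕ → StackProg
  | [] => .skip
  | s :: ts => .seq (.push s b) (pushAll b ts)

theorem runsWithin_pushAll (b : Bool) {ts : List ℕ} (hts : ts.Nodup) (σ : ℕ → List Bool) :
    RunsWithin (pushAll b ts) σ (ts.length + 1) (putOn ts [b] σ) := by
  induction ts generalizing σ with
  | nil =>
    have e : putOn [] [b] σ = σ := by funext s; simp [putOn]
    rw [e]
    exact ⟨1, by simp, .skip σ⟩
  | cons s ts ih =>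
    rw [List.nodup_cons] at hts
    have h := (runsWithin_push s b σ).seq (ih hts.2 (Function.update σ s (b :: σ s)))
    have e : putOn (s :: ts) [b] σ = putOn ts [b] (Function.update σ s (b :: σ s)) := by
      funext r
      by_cases hr : r = s
      · subst hr; simp [putOn, hts.1]
      · simp [putOn, hr]
    rw [e]
    exact h.mono (by simp; omega)

/-- Empty stack `r`, pushing the image under `f` of each of its bits on all stacks in `ts`. -/
def moveTo (f : Bool → Bool) (r : ℕ) (ts : List ℕ) : StackProg :=
  .loop r (.branch r (.seq (.pop r) (pushAll (f true) ts)) (.seq (.pop r) (pushAll (f false) ts))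
    .skip)

theorem runsWithin_moveTo (f : Bool → Bool) {r : ℕ} {ts : List ℕ} (hr : r ∉ ts) (hts : ts.Nodup)
    {σ : ℕ → List Bool} {l : List Bool} (hl : σ r = l) :
    RunsWithin (moveTo f r ts) σ (l.length * (ts.length + 4) + 1)
      (Function.update (putOn ts (l.map f).reverse σ) r []) := by
  induction l generalizing σ with
  | nil =>
    have e : Function.update (putOn ts (([] : List Bool).map f).reverse σ) r [] = σ := by
      funext s
      by_cases hs : s = r
      · subst hs; simp [hl]
      · simp [putOn, hs]
    rw [e]
    exact ⟨1, by simp, .loop_done hl⟩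
  | cons b l ih =>
    obtain ⟨t, ht, e₁⟩ := (runsWithin_pop hl).seq (runsWithin_pushAll (f b) hts _)
    obtain ⟨u, hu, e₂⟩ := ih (σ := putOn ts [f b] (Function.update σ r l)) (by simp [putOn, hr])
    have e : Function.update (putOn ts ((b :: l).map f).reverse σ) r [] =
        Function.update (putOn ts (l.map f).reverse
          (putOn ts [f b] (Function.update σ r l))) r [] := by
      funext s
      by_cases hs : s = r
      · subst hs; simp
      · by_cases hs' : s ∈ ts <;> simp [putOn, hs, hs']
    rw [e]
    refine ⟨(t + 1) + u + 1, ?_, .loop_step (by simp [hl]) ?_ e₂⟩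
    · rw [List.length_cons, Nat.add_mul]; omega
    · cases b
      · exact .branch_false (by simp [hl]) e₁
      · exact .branch_true (by simp [hl]) e₁

/-- For a unary number `a` on stack `A` and a unary number `k` on stack `X`, put their product on
stack `A`, using the empty stacks `Y` and `B`. -/
def mulStep (X A Y B : ℕ) : StackProg :=
  .seq (.loop A (.seq (.pop A) (.seq (moveTo id X [Y, B]) (moveTo id Y [X])))) (moveTo id B [A])

/-- The invariant of the main loop of `mulStep`: the value on `B` plus the product of those on `A`
and `X` stays the same. -/
theorem runsWithin_mulLoop {X A Y B : ℕ} (h : [X, A, Y, B].Nodup) {σ : ℕ → List Bool} {k a b : ℕ}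
    (hX : σ X = List.replicate k true) (hA : σ A = List.replicate a true) (hY : σ Y = [])
    (hB : σ B = List.replicate b true) :
    RunsWithin (.loop A (.seq (.pop A) (.seq (moveTo id X [Y, B]) (moveTo id Y [X])))) σ
      (a * (11 * k + 4) + 1)
      (Function.update (Function.update σ A []) B (List.replicate (a * k + b) true)) := by
  simp only [List.nodup_cons, List.mem_cons, List.not_mem_nil, or_false, not_or, not_false_eq_true,
    List.nodup_nil, and_true] at h
  obtain ⟨⟨hXA, hXY, hXB⟩, ⟨hAY, hAB⟩, hYB⟩ := h
  induction a generalizing σ b with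
  | zero =>
    have e : Function.update (Function.update σ A []) B (List.replicate (0 * k + b) true) = σ := by
      funext s
      by_cases hs : s = B
      · subst hs; simp [hB]
      · by_cases hs' : s = A
        · subst hs'; simp [hA, hs]
        · simp [hs, hs']
    rw [e]
    exact ⟨1, by simp, .loop_done (by simpa using hA)⟩
  | succ a ih =>
    obtain ⟨t, ht, e₁⟩ := (runsWithin_pop (σ := σ) (r := A) (by rw [hA, List.replicate_succ])).seq
      ((runsWithin_moveTo id (r := X) (ts := [Y, B]) (l := List.replicate k true)
        (by simp [hXY, hXB]) (by simp [hYB]) (by simp [hX, hXA])).seq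
      (runsWithin_moveTo id (r := Y) (ts := [X]) (l := List.replicate k true)
        (by simp [Ne.symm hXY]) (by simp)
        (by simp [putOn, hY, Ne.symm hXY, Ne.symm hAY])))
    obtain ⟨u, hu, e₂⟩ := ih (b := k + b)
      (σ := Function.update (Function.update σ A (List.replicate a true)) B
        (List.replicate (k + b) true)) (by simp [hX, hXA, hXB]) (by simp [hAB])
        (by simp [hY, hYB, Ne.symm hAY]) (by simp)
    refine ⟨t + u + 1, ?_, .loop_step (τ := Function.update
      (Function.update σ A (List.replicate a true)) B (List.replicate (k + b) true))
      (by simp [hA, List.replicate_succ]) ?_ ?_⟩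
    · simp only [List.length_replicate, List.length_cons, List.length_nil] at ht
      nlinarith
    · convert e₁ using 1
      funext s
      by_cases hs : s = B
      · subst hs; simp [putOn, hB, Ne.symm hYB, Ne.symm hXB, Ne.symm hAB]
      · by_cases hs' : s = Y
        · subst hs'; simp [hY, hs, Ne.symm hAY]
        · by_cases hs'' : s = X
          · subst hs''; simp [putOn, hs, hs', hX, hXA]
          · simp [putOn, hs, hs', hs'']
    · convert e₂ using 1
      funext s
      by_cases hs : s = B
      · subst hs; simp; ring
      · by_cases hs' : s = A
        · subst hs'; simp [hs]
        · simp [hs, hs']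

theorem runsWithin_mulStep {X A Y B : ℕ} (h : [X, A, Y, B].Nodup) {σ : ℕ → List Bool} {k a : ℕ}
    (hX : σ X = List.replicate k true) (hA : σ A = List.replicate a true) (hY : σ Y = [])
    (hB : σ B = []) :
    RunsWithin (mulStep X A Y B) σ (a * (16 * k + 4) + 2)
      (Function.update σ A (List.replicate (a * k) true)) := by
  have h₁ := runsWithin_mulLoop h hX hA hY (b := 0) (by simpa using hB)
  simp only [List.nodup_cons, List.mem_cons, List.not_mem_nil, or_false, not_or, not_false_eq_true,
    List.nodup_nil, and_true] at h
  have h₂ := h₁.seq (runsWithin_moveTo id (r := B) (ts := [A])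
    (l := List.replicate (a * k) true) (by simp [Ne.symm h.2.1.2]) (by simp) (by simp))
  have e : Function.update σ A (List.replicate (a * k) true) = Function.update (putOn [A]
      ((List.replicate (a * k) true).map id).reverse (Function.update (Function.update σ A []) B
        (List.replicate (a * k + 0) true))) B [] := by
    funext s
    by_cases hs : s = B
    · subst hs; simp [hB, Ne.symm h.2.1.2]
    · by_cases hs' : s = A
      · subst hs'; simp [putOn, hs]
      · simp [putOn, hs, hs']
  rw [e]
  exact h₂.mono (by simp; nlinarith)

/-- Multiply the unary number on stack `A` by the `d`-th power of the one on stack `X`. -/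
def mulPow (X A Y B : ℕ) : ℕ → StackProg
  | 0 => .skip
  | d + 1 => .seq (mulPow X A Y B d) (mulStep X A Y B)

theorem runsWithin_mulPow {X A Y B : ℕ} (h : [X, A, Y, B].Nodup) {σ : ℕ → List Bool} {k : ℕ}
    (hk : 0 < k) (hX : σ X = List.replicate k true) (hA : σ A = [true]) (hY : σ Y = [])
    (hB : σ B = []) (d : ℕ) :
    RunsWithin (mulPow X A Y B d) σ (d * (k ^ d * (16 * k + 4) + 2) + 1)
      (Function.update σ A (List.replicate (k ^ d) true)) := by
  have h' := h
  simp only [List.nodup_cons, List.mem_cons, List.not_mem_nil, or_false, not_or, not_false_eq_true,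
    List.nodup_nil, and_true] at h'
  induction d with
  | zero =>
    refine ⟨1, by simp, ?_⟩
    have e : Function.update σ A (List.replicate (k ^ 0) true) = σ := by
      rw [← Function.update_eq_self A σ]; simp [hA]
    rw [e]
    exact .skip σ
  | succ d ih =>
    have h₂ := ih.seq (runsWithin_mulStep h (k := k) (a := k ^ d) (by simp [hX, h'.1.1]) (by simp)
      (by simp [hY, Ne.symm h'.2.1.1]) (by simp [hB, Ne.symm h'.2.1.2]))
    rw [Function.update_idem, ← pow_succ] at h₂
    refine h₂.mono ?_
    have : k ^ d ≤ k ^ (d + 1) := Nat.pow_le_pow_right hk (by omega)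
    have h3 : k ^ d * (16 * k + 4) ≤ k ^ (d + 1) * (16 * k + 4) := Nat.mul_le_mul_right _ this
    have h4 := Nat.mul_le_mul_left d h3
    nlinarith

/-- Remove a unary number and its terminating `false` from the top of stack `0`. Loops test for
emptiness only, so that stack `F`, initially empty, serves as a flag. -/
def dropUnary (F : ℕ) : StackProg :=
  .seq (.push F true)
    (.loop F (.branch 0 (.pop 0) (.seq (.pop 0) (.pop F)) (.pop F)))

theorem exec_dropUnaryLoop {F : ℕ} (hF : F ≠ 0) {σ : ℕ → List Bool} {n : ℕ} {l : List Bool}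
    (h0 : σ 0 = encodeUnary n ++ l) (hσ : σ F = [true]) :
    Exec (.loop F (.branch 0 (.pop 0) (.seq (.pop 0) (.pop F)) (.pop F))) σ (3 * n + 5)
      (Function.update (Function.update σ 0 l) F []) := by
  induction n generalizing σ with
  | zero =>
    have h0' : σ 0 = false :: l := by simpa [encodeUnary] using h0
    have e₁ := (Exec.pop 0 σ).seq (Exec.pop F _)
    simp only [h0', List.tail_cons, Function.update_of_ne hF, hσ] at e₁
    exact .loop_step (by simp [hσ]) (.branch_false (by simp [h0']) e₁) (.loop_done (by simp))
  | succ n ih =>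
    have h0' : σ 0 = true :: (encodeUnary n ++ l) := by
      simpa [encodeUnary, List.replicate_succ] using h0
    have e₁ := Exec.pop 0 σ
    simp only [h0', List.tail_cons] at e₁
    have e₂ := ih (σ := Function.update σ 0 (encodeUnary n ++ l)) (by simp) (by simp [hF, hσ])
    rw [Function.update_idem] at e₂
    convert Exec.loop_step (by simp [hσ]) (.branch_true (by simp [h0']) e₁) e₂ using 1
    omega

theorem runsWithin_dropUnary {F : ℕ} (hF : F ≠ 0) {σ : ℕ → List Bool} {n : ℕ} {l : List Bool}
    (h0 : σ 0 = encodeUnary n ++ l) (hσ : σ F = []) :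
    RunsWithin (dropUnary F) σ (3 * n + 6) (Function.update σ 0 l) := by
  have e := (Exec.push F true σ).seq (exec_dropUnaryLoop hF (n := n) (l := l)
    (by simp [hF.symm, h0]) (by simp [hσ]))
  refine ⟨1 + (3 * n + 5), by omega, ?_⟩
  have e' : Function.update σ 0 l =
      Function.update (Function.update (Function.update σ F (true :: σ F)) 0 l) F [] := by
    funext s
    by_cases hs : s = F
    · subst hs; simp [hF, hσ]
    · simp [hs, Function.update_apply]
  rw [e']
  exact e

/-! ### The reduction as a stack program -/

/-- From an input `x` on stack `0`, compute the unary number `(|x| + c) ^ d` on each of the stacks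
`K + 5`, `K + 6`, `K + 7`, keeping `x` and using only further stacks above `K`. -/
def prepareProg (K c d : ℕ) : StackProg :=
  .seq (moveTo id 0 [K + 2, K + 4]) <| .seq (moveTo id (K + 2) [0]) <|
  .seq (moveTo (fun _ => true) (K + 4) [K + 1]) <|
  .seq (pushList (K + 1) (List.replicate c true)) <| .seq (.push (K + 3) true) <|
  .seq (mulPow (K + 1) (K + 3) (K + 2) (K + 4) d) <| moveTo id (K + 3) [K + 5, K + 6, K + 7]

theorem runsWithin_prepareProg (K : ℕ) {c : ℕ} (hc : 0 < c) (d : ℕ) (x : List Bool) :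
    ∃ τ, RunsWithin (prepareProg K c d) (Function.update (fun _ => []) 0 x)
        (16 * x.length + c + d * ((x.length + c) ^ d * (16 * (x.length + c) + 4) + 2) +
          7 * (x.length + c) ^ d + 7) τ ∧
      (∀ s < K + 1, τ s = Function.update (fun _ => []) 0 x s) ∧
      τ (K + 3) = [] ∧ τ (K + 4) = [] ∧
      τ (K + 5) = List.replicate ((x.length + c) ^ d) true ∧
      τ (K + 6) = List.replicate ((x.length + c) ^ d) true ∧
      τ (K + 7) = List.replicate ((x.length + c) ^ d) true := by
  have h := (runsWithin_moveTo id (r := 0) (ts := [K + 2, K + 4])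
      (σ := Function.update (fun _ => []) 0 x) (l := x) (by simp) (by simp) (by simp)).seq <|
    (runsWithin_moveTo id (r := K + 2) (ts := [0]) (l := x.reverse) (by simp) (by simp)
      (by simp [putOn])).seq <|
    (runsWithin_moveTo (fun _ => true) (r := K + 4) (ts := [K + 1]) (l := x.reverse) (by simp)
      (by simp) (by simp [putOn])).seq <|
    (runsWithin_pushList (K + 1) (List.replicate c true) _).seq <|
    (runsWithin_push (K + 3) true _).seq <|
    (runsWithin_mulPow (X := K + 1) (A := K + 3) (Y := K + 2) (B := K + 4) (k := x.length + c)
      (by simp) (by omega)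
      (by simp [putOn, add_comm])
      (by simp [putOn]) (by simp [putOn]) (by simp [putOn]) d).seq <|
    (runsWithin_moveTo id (r := K + 3) (ts := [K + 5, K + 6, K + 7])
      (l := List.replicate ((x.length + c) ^ d) true) (by simp) (by simp) (by simp))
  refine ⟨_, h.mono ?_, fun s hs => ?_, ?_, ?_, ?_, ?_, ?_⟩
  · simp only [List.length_reverse, List.length_cons, List.length_nil, List.length_replicate]
    omega
  · have h1 : s ≠ K + 1 := by omega
    have h2 : s ≠ K + 2 := by omega
    have h3 : s ≠ K + 3 := by omega
    have h4 : s ≠ K + 4 := by omega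
    have h5 : s ≠ K + 5 := by omega
    have h6 : s ≠ K + 6 := by omega
    have h7 : s ≠ K + 7 := by omega
    by_cases h0 : s = 0
    · subst h0; simp [putOn]
    · simp [putOn, h0, h1, h2, h3, h4, h5, h6, h7]
  all_goals simp [putOn]

/-- Code of the controlled `Z` between qubits `0` and `k`. -/
def controlledZCode (k : ℕ) : List Bool :=
  [true, false, false, false, true, true, true] ++ List.replicate k true ++
    [false, false, true, false, false, false]

/-- Put the code of the controlled `Z` between qubits `0` and `k` on stack `0`, where `k` is the
unary number on stack `C`. -/
def writeControlledZ (C : ℕ) : StackProg :=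
  .seq (pushList 0 [false, false, true, false, false, false]) <| .seq (moveTo id C [0]) <|
    pushList 0 [true, false, false, false, true, true, true]

theorem runsWithin_writeControlledZ {C : ℕ} (hC : C ≠ 0) {σ : ℕ → List Bool} {k : ℕ}
    (h : σ C = List.replicate k true) :
    RunsWithin (writeControlledZ C) σ (5 * k + 16)
      (Function.update (Function.update σ 0 (controlledZCode k ++ σ 0)) C []) := by
  have h := (runsWithin_pushList 0 [false, false, true, false, false, false] σ).seq <|
    (runsWithin_moveTo id (r := C) (ts := [0]) (l := List.replicate k true) (by simpa using hC)
      (by simp) (by simp [hC, h])).seq <|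
    runsWithin_pushList 0 [true, false, false, false, true, true, true] _
  have e : ∀ υ, υ = Function.update (putOn [0] ((List.replicate k true).map id).reverse
        (Function.update σ 0 ([false, false, true, false, false, false] ++ σ 0))) C [] →
      Function.update (Function.update σ 0 (controlledZCode k ++ σ 0)) C [] =
        Function.update υ 0 ([true, false, false, false, true, true, true] ++ υ 0) := by
    rintro _ rfl
    funext s
    by_cases h0 : s = 0
    · subst h0; simp [putOn, hC.symm, controlledZCode]
    · by_cases h1 : s = C
      · subst h1; simp [h0]
      · simp [putOn, h0, h1]
  rw [e _ rfl]
  exact h.mono (by simp; omega)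

/-- From the code of a one-clean-qubit circuit on stack `0`, and a unary number `k` on each of
stacks `K + 5`, `K + 6`, `K + 7`, compute the code of the pair of circuits on `k + 1` qubits that
consists of the conjugate of the given one by a controlled `Z` and of the given one. -/
def pairProg (K : ℕ) : StackProg :=
  .seq (dropUnary (K + 3)) <| .seq (moveTo id 0 [K + 3, K + 4]) <|
  .seq (moveTo id (K + 3) [0]) <| .seq (.pop (K + 4)) <| .seq (pushList 0 [false]) <|
  .seq (writeControlledZ (K + 5)) <| .seq (moveTo id (K + 4) [0]) <|
  .seq (writeControlledZ (K + 6)) <| .seq (pushList 0 [true, false]) <|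
  moveTo id (K + 7) [0]

theorem runsWithin_pairProg (K : ℕ) {σ : ℕ → List Bool} {n k : ℕ} {l : List Bool}
    (h0 : σ 0 = encodeUnary n ++ (l ++ [false])) (hA : σ (K + 3) = []) (hB : σ (K + 4) = [])
    (h5 : σ (K + 5) = List.replicate k true) (h6 : σ (K + 6) = List.replicate k true)
    (h7 : σ (K + 7) = List.replicate k true) :
    ∃ τ, RunsWithin (pairProg K) σ (3 * n + 16 * l.length + 15 * k + 70) τ ∧
      τ 0 = encodeUnary (k + 1) ++
        (controlledZCode k ++ l ++ controlledZCode k ++ [false]) ++ (l ++ [false]) := by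
  have h := (runsWithin_dropUnary (F := K + 3) (by simp) h0 hA).seq <|
    (runsWithin_moveTo id (r := 0) (ts := [K + 3, K + 4]) (l := l ++ [false]) (by simp) (by simp)
      (by simp)).seq <|
    (runsWithin_moveTo id (r := K + 3) (ts := [0]) (l := false :: l.reverse) (by simp) (by simp)
      (by simp [putOn, hA])).seq <|
    (runsWithin_pop (r := K + 4) (b := false) (l := l.reverse) (by simp [putOn, hB])).seq <|
    (runsWithin_pushList 0 [false] _).seq <|
    (runsWithin_writeControlledZ (C := K + 5) (k := k) (by simp) (by simp [putOn, h5])).seq <|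
    (runsWithin_moveTo id (r := K + 4) (ts := [0]) (l := l.reverse) (by simp) (by simp)
      (by simp)).seq <|
    (runsWithin_writeControlledZ (C := K + 6) (k := k) (by simp) (by simp [putOn, h6])).seq <|
    (runsWithin_pushList 0 [true, false] _).seq <|
    (runsWithin_moveTo id (r := K + 7) (ts := [0]) (l := List.replicate k true) (by simp) (by simp)
      (by simp [putOn, h7]))
  refine ⟨_, h.mono ?_, ?_⟩
  · simp only [List.length_reverse, List.length_cons, List.length_nil, List.length_replicate,
      List.length_append]
    omega
  · simp [putOn, encodeUnary, List.replicate_succ']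

/-- If `f` computes codes of one-clean-qubit circuits in polynomial time, then the associated pairs
of circuits on `(|x| + c) ^ d + 1` qubits are computed in polynomial time. -/
theorem polyTimeComputable_pair {α β : Type} {enc : α → List Bool} {f : List Bool → α}
    (hf : PolyTimeComputable enc f) {enc' : β → List Bool} {g : List Bool → β}
    {n : List Bool → ℕ} {l : List Bool → List Bool} {c d : ℕ} (hc : 0 < c)
    (henc : ∀ x, enc (f x) = encodeUnary (n x) ++ (l x ++ [false]))
    (henc' : ∀ x, enc' (g x) = encodeUnary ((x.length + c) ^ d + 1) ++
      (controlledZCode ((x.length + c) ^ d) ++ l x ++ controlledZCode ((x.length + c) ^ d) ++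
        [false]) ++ (l x ++ [false])) :
    PolyTimeComputable enc' g := by
  obtain ⟨prog, p, hp⟩ := hf
  refine ⟨.seq (prepareProg prog.bound c d) (.seq prog (pairProg prog.bound)),
    (16 * .X + .C c + .C d * ((.X + .C c) ^ d * (16 * (.X + .C c) + 4) + 2) +
      7 * (.X + .C c) ^ d + 7) + (p + (16 * (.X + p) + 15 * (.X + .C c) ^ d + 70)), fun x => ?_⟩
  obtain ⟨t, τ, e, ht, hτ⟩ := hp x
  obtain ⟨τ₁, ⟨t₁, ht₁, e₁⟩, hlt, hA, hB, h5, h6, h7⟩ :=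
    runsWithin_prepareProg prog.bound hc d x
  obtain ⟨τ₂, e₂, hlt₂, hge⟩ := e.frame (Nat.le_succ prog.bound) hlt
  obtain ⟨τ₃, ⟨t₃, ht₃, e₃⟩, h0⟩ := runsWithin_pairProg prog.bound (σ := τ₂) (n := n x)
    (k := (x.length + c) ^ d) (l := l x)
    (by rw [hlt₂ 0 (by omega), hτ, henc])
    (by rw [hge _ (by omega), hA]) (by rw [hge _ (by omega), hB])
    (by rw [hge _ (by omega), h5]) (by rw [hge _ (by omega), h6])
    (by rw [hge _ (by omega), h7])
  refine ⟨_, τ₃, .seq e₁ (.seq e₂ e₃), ?_, by rw [h0, henc']⟩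
  have hlen := e.length_le 0
  rw [hτ, henc] at hlen
  simp only [encodeUnary, List.length_append, List.length_replicate, List.length_cons,
    List.length_nil, Function.update_self] at hlen
  simp only [Polynomial.eval_add, Polynomial.eval_mul, Polynomial.eval_pow, Polynomial.eval_X,
    Polynomial.eval_C, Polynomial.eval_ofNat]
  omega

/-! ### Hardness of the Hilbert-Schmidt test cost -/

theorem encodeGate_extend {m : ℕ} (e : ℕ) (g : Gate m) :
    encodeGate (g.extend e) = encodeGate g := by
  cases g <;> rfl

theorem encodeGates_map_extend {m : ℕ} (e : ℕ) (C : Circuit m) :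
    encodeGates (C.map (Gate.extend e)) = encodeGates C := by
  induction C with
  | nil => rfl
  | cons g C ih => simp only [List.map_cons, encodeGates, ih, encodeGate_extend]

/-- The code of a concatenation keeps the end mark of the second circuit only. -/
theorem encodeGates_append {n : ℕ} (C D : Circuit n) :
    encodeGates (C ++ D) = (encodeGates C).dropLast ++ encodeGates D := by
  induction C with
  | nil => rfl
  | cons g C ih =>
    have h : encodeGates C ≠ [] := by cases C <;> simp [encodeGates]
    simp only [List.cons_append, encodeGates, ih]
    rw [List.dropLast_cons_of_ne_nil (by simp [h]), List.dropLast_append_of_ne_nil h]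
    simp

theorem encodeGates_eq_dropLast_append {n : ℕ} (C : Circuit n) :
    encodeGates C = (encodeGates C).dropLast ++ [false] := by
  simpa [encodeGates] using encodeGates_append C []

theorem length_le_length_encodeGates {n : ℕ} (C : Circuit n) :
    C.length ≤ (encodeGates C).length := by
  induction C with
  | nil => simp
  | cons g C ih => simp only [encodeGates, List.length_cons, List.length_append]; omega

theorem encodeGates_controlledZ (n e : ℕ) :
    encodeGates (controlledZ n e) = controlledZCode (n + 1 + e) ++ [false] := by
  simp [controlledZ, encodeGates, encodeGate, encodeUnary, controlledZCode]

/-- Every polynomial with natural coefficients is dominated by a single shifted power. -/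
theorem exists_eval_le_pow (p : Polynomial ℕ) : ∃ c d : ℕ, 0 < c ∧ ∀ m, p.eval m ≤ (m + c) ^ d := by
  induction p using Polynomial.induction_on' with
  | add p q hp hq =>
    obtain ⟨c₁, d₁, h₁, hp⟩ := hp
    obtain ⟨c₂, d₂, h₂, hq⟩ := hq
    refine ⟨c₁ + c₂, d₁ + d₂ + 1, by omega, fun m => ?_⟩
    have e₁ : (m + c₁) ^ d₁ ≤ (m + (c₁ + c₂)) ^ (d₁ + d₂) :=
      (Nat.pow_le_pow_left (by omega) _).trans (Nat.pow_le_pow_right (by omega) (by omega))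
    have e₂ : (m + c₂) ^ d₂ ≤ (m + (c₁ + c₂)) ^ (d₁ + d₂) :=
      (Nat.pow_le_pow_left (by omega) _).trans (Nat.pow_le_pow_right (by omega) (by omega))
    calc (p + q).eval m ≤ (m + (c₁ + c₂)) ^ (d₁ + d₂) * 2 := by
          rw [Polynomial.eval_add]; linarith [hp m, hq m]
      _ ≤ (m + (c₁ + c₂)) ^ (d₁ + d₂) * (m + (c₁ + c₂)) := Nat.mul_le_mul_left _ (by omega)
  | monomial n a =>
    refine ⟨a + 1, n + 1, by omega, fun m => ?_⟩
    rw [Polynomial.eval_monomial, pow_succ, mul_comm]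
    exact Nat.mul_le_mul (Nat.pow_le_pow_left (by omega) _) (by omega)

/-- The code of a value computed in polynomial time has polynomial length. -/
theorem PolyTimeComputable.exists_length_le {β : Type} {enc : β → List Bool} {f : List Bool → β}
    (hf : PolyTimeComputable enc f) :
    ∃ p : Polynomial ℕ, ∀ x, (enc (f x)).length ≤ p.eval x.length := by
  obtain ⟨prog, p, hp⟩ := hf
  refine ⟨.X + p, fun x => ?_⟩
  obtain ⟨t, τ, e, ht, hτ⟩ := hp x
  have := e.length_le 0
  rw [hτ, Function.update_self] at this
  simp only [Polynomial.eval_add, Polynomial.eval_X]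
  omega

/-- The Hilbert-Schmidt test instance attached to a one-clean-qubit circuit: its conjugate by the
controlled `Z` against the circuit itself, with `e + 1` additional qubits. -/
def testPair (Q : OneCleanQubitCircuit) (e : ℕ) : CircuitPair where
  n := Q.n + 1 + (e + 1)
  U := controlledZ Q.n e ++ Q.circuit.map (Gate.extend (e + 1)) ++ controlledZ Q.n e
  V := Q.circuit.map (Gate.extend (e + 1))

theorem encode_testPair (Q : OneCleanQubitCircuit) (e : ℕ) : (testPair Q e).encode =
    encodeUnary (Q.n + 1 + e + 1) ++ (controlledZCode (Q.n + 1 + e) ++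
      (encodeGates Q.circuit).dropLast ++ controlledZCode (Q.n + 1 + e) ++ [false]) ++
        ((encodeGates Q.circuit).dropLast ++ [false]) := by
  rw [CircuitPair.encode, testPair, encodeGates_append, encodeGates_append,
    encodeGates_controlledZ, encodeGates_map_extend, ← encodeGates_eq_dropLast_append]
  obtain ⟨b, hb⟩ : ∃ b, encodeGates Q.circuit = b ++ [false] :=
    ⟨_, encodeGates_eq_dropLast_append _⟩
  simp only [hb, ← List.append_assoc, List.dropLast_concat, ← Nat.add_assoc]

theorem length_testPair_U (Q : OneCleanQubitCircuit) (e : ℕ) :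
    (testPair Q e).U.length = Q.circuit.length + 6 := by
  simp [testPair, controlledZ]

theorem length_testPair_V (Q : OneCleanQubitCircuit) (e : ℕ) :
    (testPair Q e).V.length = Q.circuit.length := by
  simp [testPair]

end

theorem mainTheorem3 :
    ∃ s : Polynomial ℕ, ∀ ε : ℕ → ℝ, (∀ n, 0 < ε n) →
      (∃ k : ℕ, 0 < k ∧ ε =O[atTop] fun n : ℕ => 1 / (n : ℝ) ^ k) →
      DQC1Hard (approxCostHST s ε) := by
  refine ⟨.X + 6, fun ε _ ⟨k, hk, hO⟩ L ⟨Q, hQ, q, hq, hyes, hno⟩ => ?_⟩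
  obtain ⟨C, hC⟩ := hO.bound
  obtain ⟨N₀, hN₀⟩ := eventually_atTop.mp hC
  obtain ⟨r, hr⟩ := hQ.exists_length_le
  -- `(|x| + c) ^ d + 1` qubits accommodate `Q x` and its size, lie in the asymptotic range of `ε`,
  -- and make the precision smaller than the distance `1 / (2 q)` of the costs from `3 / 4`.
  obtain ⟨c, d, hc, hcd⟩ := exists_eval_le_pow (r + .C N₀ + .C (2 * ⌈C⌉₊) * q)
  simp only [Polynomial.eval_add, Polynomial.eval_mul, Polynomial.eval_C] at hcd
  have hlen (x : List Bool) : (Q x).n + 1 + (Q x).circuit.length ≤ r.eval x.length := by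
    refine le_trans ?_ (hr x)
    have := length_le_length_encodeGates (Q x).circuit
    simp only [OneCleanQubitCircuit.encode, encodeUnary, List.length_append,
      List.length_replicate, List.length_cons, List.length_nil]
    omega
  have hsize (x : List Bool) : (Q x).n + 1 + ((x.length + c) ^ d - ((Q x).n + 1)) =
      (x.length + c) ^ d := by
    have := hlen x
    have := hcd x.length
    omega
  have hn (x : List Bool) : (testPair (Q x) ((x.length + c) ^ d - ((Q x).n + 1))).n =
      (x.length + c) ^ d + 1 := by
    simp only [testPair]
    have := hsize x
    omega
  refine ⟨fun x => testPair (Q x) ((x.length + c) ^ d - ((Q x).n + 1)),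
    polyTimeComputable_pair hQ hc (n := fun x => (Q x).n)
      (l := fun x => (encodeGates (Q x).circuit).dropLast) (d := d) (fun x => ?_) (fun x => ?_),
    fun x => ?_, 3 / 4, fun x a ha => ?_⟩
  · rw [OneCleanQubitCircuit.encode, ← encodeGates_eq_dropLast_append]
  · simp only [approxCostHST, encode_testPair, hsize]
  · have h₁ := hlen x
    have h₂ := hcd x.length
    have h₃ := hn x
    have hU := length_testPair_U (Q x) ((x.length + c) ^ d - ((Q x).n + 1))
    have hV := length_testPair_V (Q x) ((x.length + c) ^ d - ((Q x).n + 1))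
    have hs : Polynomial.eval (testPair (Q x) ((x.length + c) ^ d - ((Q x).n + 1))).n
        (.X + 6 : Polynomial ℕ) = (x.length + c) ^ d + 1 + 6 := by
      rw [h₃, Polynomial.eval_add, Polynomial.eval_X, Polynomial.eval_ofNat]
    exact ⟨hU.le.trans (by rw [hs]; omega), hV.le.trans (by rw [hs]; omega)⟩
  · simp only [ApproxProblem.IsSolution, approxCostHST, hn x] at ha
    rw [show costHST (circuitMatrix (testPair (Q x) _).U) (circuitMatrix (testPair (Q x) _).V) = _
      from costHST_controlledZ_conj (Q x) _] at ha
    have hq0 : (0 : ℝ) < (q.eval x.length : ℕ) := by exact_mod_cast hq _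
    have hε : ε ((x.length + c) ^ d + 1) < 1 / (2 * ((q.eval x.length : ℕ) : ℝ)) := by
      have h₂ := hcd x.length
      set M := (x.length + c) ^ d + 1 with hM
      have hM1 : (1 : ℝ) ≤ M := by exact_mod_cast Nat.le_add_left 1 _
      have h₃ : ε M ≤ C * (1 / (M : ℝ) ^ k) := by
        have := hN₀ M (by omega)
        rw [Real.norm_eq_abs, Real.norm_of_nonneg (by positivity)] at this
        exact (le_abs_self _).trans this
      have h₄ : (2 * ⌈C⌉₊ * q.eval x.length : ℕ) < (M : ℝ) := by
        exact_mod_cast (by omega : 2 * ⌈C⌉₊ * q.eval x.length < M)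
      push_cast at h₄
      have h₅ : C ≤ ⌈C⌉₊ := Nat.le_ceil C
      calc ε M ≤ C * (1 / (M : ℝ) ^ k) := h₃
        _ ≤ ⌈C⌉₊ * (1 / (M : ℝ) ^ k) := by gcongr
        _ ≤ ⌈C⌉₊ * (1 / (M : ℝ)) := by
          gcongr
          exact le_self_pow₀ hM1 hk.ne'
        _ < 1 / (2 * ((q.eval x.length : ℕ) : ℝ)) := by
          rw [mul_one_div, div_lt_div_iff₀ (by linarith) (by positivity)]
          linarith
    have hδ : (1 : ℝ) / ((q.eval x.length : ℕ) : ℝ) =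
        2 * (1 / (2 * ((q.eval x.length : ℕ) : ℝ))) := by field_simp
    have hδ0 : 0 < 1 / (2 * ((q.eval x.length : ℕ) : ℝ)) := by positivity
    have hy := hyes x
    have hn' := hno x
    rw [hδ] at hy hn'
    set δ := 1 / (2 * ((q.eval x.length : ℕ) : ℝ))
    have hp := (Q x).acceptProb_nonneg
    obtain ⟨ha₁, ha₂⟩ := abs_le.mp ha
    push_cast
    -- The cost is `1 - p ^ 2`. If `p ≥ 1 / 2 + 2 δ`, then `p ^ 2 ≥ 1 / 4 + 2 δ`. If
    -- `0 ≤ p ≤ 1 / 2 - 2 δ`, then `2 δ ≤ 1 / 2`, whence `p ^ 2 ≤ (1 / 2 - 2 δ) / 2 = 1 / 4 - δ`.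
    constructor
    · intro hx
      nlinarith [hy hx]
    · intro hx
      nlinarith [hn' hx]
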